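/- For nonzero integers $m,n$ let $\mathrm{BS}(m,n)=\langle a,t \mid t a^m t^{-1}=a^n\rangle$ be the Baumslag--Solitar group, and let $\mathrm{G}(m,n)$ be its relative profinite completion with respect to the commensurated subgroup $\langle a\rangle$, that is, the closure of the image of $\mathrm{BS}(m,n)$, acting by left multiplication on $\mathrm{BS}(m,n)/\langle a\rangle$, in the group $\mathrm{Sym}(\mathrm{BS}(m,n)/\langle a\rangle)$ of all permutations with the topology of pointwise convergence (for the discrete topology on $\mathrm{BS}(m,n)/\langle a\rangle$). Theorem. Let $m,n,p,q$ be integers with $2\le |m|\le n$ and $2\le |p|\le q$. Then $\mathrm{G}(m,n)$ and $\mathrm{G}(p,q)$ are isomorphic as topological groups (via a group isomorphism that is a homeomorphism) if and only if - either $|m|=n=|p|=q$, - or $|m|\neq n$ and $(m,n)=(p,q)$. In particular, if $|m|\neq n$, then $\mathrm{G}(m,n)$ and $\mathrm{G}(-m,n)$ are not isomorphic as topological groups. -/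

import Mathlib

/-- The topology of pointwise convergence on the group `Sym(X)` of all permutations of a set `X`,
where `X` carries the discrete topology. For countable `X` this is the usual Polish topology. -/
instance permTopologicalSpace (X : Type*) : TopologicalSpace (Equiv.Perm X) :=
  TopologicalSpace.induced (fun (σ : Equiv.Perm X) (x : X) => σ x)
    (@Pi.topologicalSpace X (fun _ => X) (fun _ => ⊥))

/-- The sets of permutations sending `x` to `y` are open. -/
theorem permIsOpen_apply_eq {X : Type*} (x y : X) : IsOpen {σ : Equiv.Perm X | σ x = y} := by
  let _ : TopologicalSpace X := ⊥
  have _ : DiscreteTopology X := ⟨rfl⟩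
  have h : Continuous (fun (σ : Equiv.Perm X) => σ x) :=
    (continuous_apply x).comp continuous_induced_dom
  exact (isOpen_discrete ({y} : Set X)).preimage h

/-- A map into `Sym(X)` is continuous as soon as the preimages of the sets of permutations sending
`x` to `y` are open. -/
theorem permContinuous_of_isOpen {X Y : Type*} [TopologicalSpace Y] {f : Y → Equiv.Perm X}
    (h : ∀ x y, IsOpen {z : Y | f z x = y}) : Continuous f := by
  let _ : TopologicalSpace X := ⊥
  have _ : DiscreteTopology X := ⟨rfl⟩
  refine continuous_induced_rng.2 (continuous_pi fun x => ?_)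
  exact continuous_discrete_rng.2 fun y => h x y

/-- `Sym(X)` is a topological group. -/
instance permIsTopologicalGroup (X : Type*) : IsTopologicalGroup (Equiv.Perm X) where
  continuous_mul := by
    refine permContinuous_of_isOpen fun x y => ?_
    have h : {p : Equiv.Perm X × Equiv.Perm X | (p.1 * p.2) x = y} =
        ⋃ w : X, {σ : Equiv.Perm X | σ w = y} ×ˢ {σ : Equiv.Perm X | σ x = w} := by
      ext p
      simp [Equiv.Perm.mul_apply]
    rw [h]
    exact isOpen_iUnion fun w => (permIsOpen_apply_eq w y).prod (permIsOpen_apply_eq x w)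
  continuous_inv := by
    refine permContinuous_of_isOpen fun x y => ?_
    have h : {σ : Equiv.Perm X | σ⁻¹ x = y} = {σ : Equiv.Perm X | σ y = x} := by
      ext σ
      simp only [Set.mem_ofPred_eq, Equiv.Perm.inv_eq_iff_eq]
      exact eq_comm
    rw [h]
    exact permIsOpen_apply_eq y x

/-- The relative profinite completion of `Γ` with respect to a (commensurated) subgroup `Λ`: the
closure, in `Sym(Γ / Λ)`, of the image of `Γ` acting on `Γ / Λ` by left multiplication. It carries
the subspace topology. -/
def relativeProfiniteCompletion {Γ : Type*} [Group Γ] (Λ : Subgroup Γ) :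
    Subgroup (Equiv.Perm (Γ ⧸ Λ)) :=
  (MulAction.toPermHom Γ (Γ ⧸ Λ)).range.topologicalClosure

/-- The two letters of the standard presentation of a Baumslag-Solitar group. -/
inductive BSLetter : Type
  | a : BSLetter
  | t : BSLetter

/-- The relator of `t a ^ m t⁻¹ = a ^ n`. -/
def bsRelator (m n : ℤ) : FreeGroup BSLetter :=
  FreeGroup.of BSLetter.t * FreeGroup.of BSLetter.a ^ m * (FreeGroup.of BSLetter.t)⁻¹ *
    (FreeGroup.of BSLetter.a ^ n)⁻¹

/-- The Baumslag-Solitar group `BS(m, n) = ⟨a, t | t a ^ m t⁻¹ = a ^ n⟩`. -/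
abbrev BS (m n : ℤ) : Type := PresentedGroup ({bsRelator m n} : Set (FreeGroup BSLetter))

/-- The subgroup `⟨a⟩` of `BS(m, n)`. -/
def bsA (m n : ℤ) : Subgroup (BS m n) :=
  Subgroup.zpowers (PresentedGroup.of BSLetter.a)

/-- `G(m, n)`, the relative profinite completion of `BS(m, n)` with respect to `⟨a⟩`, as a
topological group. -/
abbrev bsCompletion (m n : ℤ) : Type := relativeProfiniteCompletion (bsA m n)

/-! Two invariants recover (m, n): the ratio n / m, when |m| < n, and gcd(m, n).

Ratio. The base stabilizer K is open and is the closure of `⟨a⟩`, so by continuity each x in K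
commutes with a and satisfies t x ^ m t⁻¹ = x ^ n. Given an isomorphism φ onto G(p, q) with |p| < q,
the open set φ(K) contains some a ^ k = φ(x) with k ≠ 0, so φ(t) conjugates a ^ (km) to a ^ (kn).
The affine action on ℚ shows that conjugation in G(p, q) scales exponents of a only by powers of q /
p, so n / m is such a power; by symmetry the two ratios agree (`div_eq_div_of_equiv`). If |m| = n,
then K has exponent dividing n, whereas a has infinite order in G(p, q); so |m| = n is itself an
invariant.

Gcd. G(m, n) maps onto (ℤ/k)² with open kernel exactly when k divides gcd(m, n)
(`exists_surjective_of_dvd`, `dvd_of_surjective`).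

Conversely, if |m| = n, then `⟨a ^ n⟩` is normal and acts trivially on the cosets of `⟨a⟩`. Dividing
it out leaves ⟨a, t | a ^ n⟩, in which the sign of m is lost. -/

open scoped Topology

/-! ### Permutation topology and relative profinite completions -/

/-- A neighbourhood of a permutation contains all permutations agreeing with it on some finite
set. -/
theorem perm_exists_finset_of_mem_nhds {X : Type*} {σ : Equiv.Perm X} {U : Set (Equiv.Perm X)}
    (hU : U ∈ 𝓝 σ) : ∃ S : Finset X, ∀ τ : Equiv.Perm X, (∀ x ∈ S, τ x = σ x) → τ ∈ U := by
  let _ : TopologicalSpace X := ⊥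
  have _ : DiscreteTopology X := ⟨rfl⟩
  rw [nhds_induced, Filter.mem_comap] at hU
  obtain ⟨V, hV, hVU⟩ := hU
  rw [nhds_pi, Filter.mem_pi'] at hV
  obtain ⟨S, T, hT, hTV⟩ := hV
  refine ⟨S, fun τ hτ => hVU (hTV fun x hx => ?_)⟩
  change τ x ∈ T x
  rw [hτ x hx]
  exact mem_of_mem_nhds (hT x)

/-- The permutations agreeing with a given one on a finite set form an open set. -/
theorem perm_isOpen_agree {X : Type*} (σ : Equiv.Perm X) (S : Finset X) :
    IsOpen {τ : Equiv.Perm X | ∀ x ∈ S, τ x = σ x} := by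
  have h : {τ : Equiv.Perm X | ∀ x ∈ S, τ x = σ x} =
      ⋂ x ∈ S, {τ : Equiv.Perm X | τ x = σ x} := by
    ext τ
    simp
  rw [h]
  exact isOpen_biInter_finset fun x _ => permIsOpen_apply_eq x (σ x)

instance permT2Space (X : Type*) : T2Space (Equiv.Perm X) := by
  let _ : TopologicalSpace X := ⊥
  have _ : DiscreteTopology X := ⟨rfl⟩
  exact T2Space.of_injective_continuous (f := fun (σ : Equiv.Perm X) (x : X) => σ x)
    DFunLike.coe_injective continuous_induced_dom

/-- The canonical homomorphism from a group to its relative profinite completion. -/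
def completionMap {Γ : Type*} [Group Γ] (Λ : Subgroup Γ) :
    Γ →* relativeProfiniteCompletion Λ :=
  (MulAction.toPermHom Γ (Γ ⧸ Λ)).codRestrict _
    fun γ => Subgroup.le_topologicalClosure _ ⟨γ, rfl⟩

theorem completionMap_apply {Γ : Type*} [Group Γ] (Λ : Subgroup Γ) (γ : Γ) (x : Γ ⧸ Λ) :
    (completionMap Λ γ).1 x = γ • x := rfl

theorem completion_exists_agree {Γ : Type*} [Group Γ] {Λ : Subgroup Γ}
    (g : relativeProfiniteCompletion Λ) (S : Finset (Γ ⧸ Λ)) :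
    ∃ γ : Γ, ∀ x ∈ S, γ • x = g.1 x := by
  have hg : g.1 ∈ closure ((MulAction.toPermHom Γ (Γ ⧸ Λ)).range : Set (Equiv.Perm (Γ ⧸ Λ))) :=
    g.2
  obtain ⟨τ, hτ, γ, rfl⟩ := mem_closure_iff.1 hg _ (perm_isOpen_agree g.1 S) fun x _ => rfl
  exact ⟨γ, hτ⟩

theorem completion_exists_finset_of_mem_nhds {Γ : Type*} [Group Γ] {Λ : Subgroup Γ}
    {g : relativeProfiniteCompletion Λ} {U : Set (relativeProfiniteCompletion Λ)}
    (hU : U ∈ 𝓝 g) : ∃ S : Finset (Γ ⧸ Λ),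
      ∀ h : relativeProfiniteCompletion Λ, (∀ x ∈ S, h.1 x = g.1 x) → h ∈ U := by
  rw [nhds_subtype, Filter.mem_comap] at hU
  obtain ⟨V, hV, hVU⟩ := hU
  obtain ⟨S, hS⟩ := perm_exists_finset_of_mem_nhds hV
  exact ⟨S, fun h hh => hVU (hS _ hh)⟩

/-- The stabilizer of the base point in the relative profinite completion. -/
def baseStabilizer {Γ : Type*} [Group Γ] (Λ : Subgroup Γ) :
    Subgroup (relativeProfiniteCompletion Λ) :=
  (MulAction.stabilizer (Equiv.Perm (Γ ⧸ Λ)) ((1 : Γ) : Γ ⧸ Λ)).comap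
    (relativeProfiniteCompletion Λ).subtype

theorem mem_baseStabilizer {Γ : Type*} [Group Γ] {Λ : Subgroup Γ}
    {g : relativeProfiniteCompletion Λ} :
    g ∈ baseStabilizer Λ ↔ g.1 ((1 : Γ) : Γ ⧸ Λ) = ((1 : Γ) : Γ ⧸ Λ) := Iff.rfl

theorem smul_coe_eq_iff {Γ : Type*} [Group Γ] {Λ : Subgroup Γ} (γ x : Γ) :
    γ • (x : Γ ⧸ Λ) = (x : Γ ⧸ Λ) ↔ x⁻¹ * γ * x ∈ Λ := by
  rw [eq_comm, MulAction.Quotient.smul_coe, QuotientGroup.eq, smul_eq_mul, mul_assoc]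

theorem isOpen_baseStabilizer {Γ : Type*} [Group Γ] (Λ : Subgroup Γ) :
    IsOpen (baseStabilizer Λ : Set (relativeProfiniteCompletion Λ)) :=
  (permIsOpen_apply_eq _ _).preimage continuous_subtype_val

/-- A closed set containing the image of `Λ` contains the stabilizer of the base point. -/
theorem baseStabilizer_subset_of_isClosed {Γ : Type*} [Group Γ] {Λ : Subgroup Γ}
    {C : Set (relativeProfiniteCompletion Λ)} (hC : IsClosed C)
    (h : ∀ γ ∈ Λ, completionMap Λ γ ∈ C) {g : relativeProfiniteCompletion Λ}
    (hg : g ∈ baseStabilizer Λ) : g ∈ C := by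
  classical
  rw [← hC.closure_eq, mem_closure_iff_nhds]
  intro U hU
  obtain ⟨S, hS⟩ := completion_exists_finset_of_mem_nhds hU
  obtain ⟨γ, hγ⟩ := completion_exists_agree g (insert ((1 : Γ) : Γ ⧸ Λ) S)
  refine ⟨completionMap Λ γ, hS _ fun x hx => hγ x (Finset.mem_insert_of_mem hx), h γ ?_⟩
  have h1 := (hγ _ (Finset.mem_insert_self _ _)).trans (mem_baseStabilizer.1 hg)
  simpa using (smul_coe_eq_iff γ 1).1 h1

theorem completion_eq_mul {Γ : Type*} [Group Γ] {Λ : Subgroup Γ}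
    (g : relativeProfiniteCompletion Λ) :
    ∃ γ : Γ, ∃ k ∈ baseStabilizer Λ, g = completionMap Λ γ * k := by
  obtain ⟨γ, hγ⟩ := completion_exists_agree g {((1 : Γ) : Γ ⧸ Λ)}
  refine ⟨γ, (completionMap Λ γ)⁻¹ * g, ?_, by group⟩
  rw [mem_baseStabilizer]
  have := hγ _ (Finset.mem_singleton_self _)
  change (completionMap Λ γ).1⁻¹ (g.1 _) = _
  rw [← this, Equiv.Perm.inv_eq_iff_eq]
  rfl

/-- The image of a group in its relative profinite completion is dense. -/
theorem completion_exists_inv_mul_mem {Γ : Type*} [Group Γ] {Λ : Subgroup Γ}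
    {N : Subgroup (relativeProfiniteCompletion Λ)}
    (hN : IsOpen (N : Set (relativeProfiniteCompletion Λ))) (g : relativeProfiniteCompletion Λ) :
    ∃ γ : Γ, g⁻¹ * completionMap Λ γ ∈ N := by
  have hU : (g⁻¹ * ·) ⁻¹' (N : Set (relativeProfiniteCompletion Λ)) ∈ 𝓝 g := by
    refine (hN.preimage (continuous_const_mul _)).mem_nhds ?_
    rw [Set.mem_preimage, inv_mul_cancel]
    exact one_mem N
  obtain ⟨S, hS⟩ := completion_exists_finset_of_mem_nhds hU
  obtain ⟨γ, hγ⟩ := completion_exists_agree g S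
  exact ⟨γ, hS _ hγ⟩

/-- A homomorphism to a group which kills the pointwise stabilizer of a finite set of cosets
extends to the relative profinite completion, with open kernel. -/
theorem exists_extension {Γ H : Type*} [Group Γ] [Group H] {Λ : Subgroup Γ} (f : Γ →* H)
    (S : Finset (Γ ⧸ Λ)) (hf : ∀ γ : Γ, (∀ x ∈ S, γ • x = x) → f γ = 1) :
    ∃ χ : relativeProfiniteCompletion Λ →* H,
      IsOpen (χ.ker : Set (relativeProfiniteCompletion Λ)) ∧
        ∀ γ, χ (completionMap Λ γ) = f γ := by
  classical
  have key : ∀ γ δ : Γ, (∀ x ∈ S, γ • x = δ • x) → f γ = f δ := by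
    intro γ δ h
    have := hf (δ⁻¹ * γ) fun x hx => by rw [mul_smul, h x hx, inv_smul_smul]
    rw [map_mul, map_inv, inv_mul_eq_one] at this
    exact this.symm
  -- The extension sends `g` to `f γ` for any `γ` agreeing with `g` on `S`; by `key` the choice is
  -- immaterial.
  choose r hr using fun g : relativeProfiniteCompletion Λ => completion_exists_agree g S
  have hfr : ∀ g γ, (∀ x ∈ S, γ • x = g.1 x) → f (r g) = f γ := fun g γ h =>
    key _ _ fun x hx => (hr g x hx).trans (h x hx).symm
  let χ : relativeProfiniteCompletion Λ →* H := MonoidHom.mk' (fun g => f (r g)) fun g h => by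
    -- Agreement with `g` on the translate `r h • S` as well makes `γ * r h` agree with `g * h` on
    -- `S`.
    obtain ⟨γ, hγ⟩ := completion_exists_agree g (S ∪ S.image fun x => r h • x)
    rw [hfr g γ fun x hx => hγ x (Finset.mem_union_left _ hx), ← map_mul]
    refine hfr _ _ fun x hx => ?_
    rw [mul_smul, hγ _ (Finset.mem_union_right _ (Finset.mem_image_of_mem _ hx)), hr h x hx]
    rfl
  refine ⟨χ, ?_, fun γ => hfr _ _ fun x _ => rfl⟩
  refine Subgroup.isOpen_of_mem_nhds _ (g := 1) ?_
  refine Filter.mem_of_superset (((perm_isOpen_agree 1 S).preimage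
    continuous_subtype_val).mem_nhds fun x _ => rfl) fun g hg => ?_
  exact (hfr g 1 fun x hx => by rw [one_smul]; exact (hg x hx).symm).trans (map_one f)

/-! ### Conjugation of powers of a in BS(m, n) -/

/-- The generator `a` of `BS(m, n)`. -/
def bsGenA (m n : ℤ) : BS m n := PresentedGroup.of BSLetter.a

/-- The generator `t` of `BS(m, n)`. -/
def bsGenT (m n : ℤ) : BS m n := PresentedGroup.of BSLetter.t

theorem bs_relation (m n : ℤ) :
    bsGenT m n * bsGenA m n ^ m * (bsGenT m n)⁻¹ = bsGenA m n ^ n := by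
  have h := PresentedGroup.one_of_mem (Set.mem_singleton (bsRelator m n))
  exact mul_inv_eq_one.1 h

theorem mem_bsA {m n : ℤ} {x : BS m n} : x ∈ bsA m n ↔ ∃ k : ℤ, bsGenA m n ^ k = x :=
  Subgroup.mem_zpowers_iff

theorem bs_induction {m n : ℤ} {p : BS m n → Prop} (one : p 1) (a : p (bsGenA m n))
    (t : p (bsGenT m n)) (mul : ∀ x y, p x → p y → p (x * y)) (inv : ∀ x, p x → p x⁻¹)
    (x : BS m n) : p x := by
  let K : Subgroup (BS m n) :=
    { carrier := {x | p x}
      mul_mem' := fun ha hb => mul _ _ ha hb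
      one_mem' := one
      inv_mem' := fun h => inv _ h }
  refine PresentedGroup.generated_by _ K (fun j => ?_) x
  cases j
  · exact a
  · exact t

/-- The homomorphism from `BS(m, n)` determined by two elements satisfying the relation. -/
def bsLift {H : Type*} [Group H] {m n : ℤ} (x y : H) (h : y * x ^ m * y⁻¹ = x ^ n) :
    BS m n →* H :=
  PresentedGroup.toGroup (f := fun l => BSLetter.casesOn l x y) (by
    rintro r rfl
    simp only [bsRelator, map_mul, map_inv, map_zpow, FreeGroup.lift_apply_of]
    rw [h, mul_inv_cancel])

theorem bsLift_genA {H : Type*} [Group H] {m n : ℤ} (x y : H) (h : y * x ^ m * y⁻¹ = x ^ n) :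
    bsLift x y h (bsGenA m n) = x := PresentedGroup.toGroup.of _

theorem bsLift_genT {H : Type*} [Group H] {m n : ℤ} (x y : H) (h : y * x ^ m * y⁻¹ = x ^ n) :
    bsLift x y h (bsGenT m n) = y := PresentedGroup.toGroup.of _

theorem bs_conj_t (m n k : ℤ) :
    bsGenT m n * bsGenA m n ^ (m * k) * (bsGenT m n)⁻¹ = bsGenA m n ^ (n * k) := by
  rw [zpow_mul, zpow_mul, ← bs_relation, conj_zpow]

theorem bs_conj_t_inv (m n k : ℤ) :
    (bsGenT m n)⁻¹ * bsGenA m n ^ (n * k) * bsGenT m n = bsGenA m n ^ (m * k) := by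
  rw [← bs_conj_t]
  group

/-- Every element of `BS(m, n)` conjugates sufficiently divisible powers of `a` to powers of `a`
with prescribed divisibility. -/
theorem bs_commensurates {m n d M N : ℤ} (hm : m = d * M) (hn : n = d * N) (x : BS m n) :
    ∀ j : ℕ, ∃ i : ℕ, ∀ k : ℤ, d * (M * N) ^ i ∣ k → ∃ l : ℤ, d * (M * N) ^ j ∣ l ∧
      x * bsGenA m n ^ k * x⁻¹ = bsGenA m n ^ l := by
  let Q : BS m n → Prop := fun x => ∀ j : ℕ, ∃ i : ℕ, ∀ k : ℤ, d * (M * N) ^ i ∣ k →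
    ∃ l : ℤ, d * (M * N) ^ j ∣ l ∧ x * bsGenA m n ^ k * x⁻¹ = bsGenA m n ^ l
  have mul : ∀ x y, Q x → Q y → Q (x * y) := by
    intro x y hx hy j
    obtain ⟨i, hi⟩ := hx j
    obtain ⟨i', hi'⟩ := hy i
    refine ⟨i', fun k hk => ?_⟩
    obtain ⟨l, hl, e⟩ := hi' k hk
    obtain ⟨l', hl', e'⟩ := hi l hl
    refine ⟨l', hl', ?_⟩
    rw [← e', ← e]
    group
  -- `Q` is not visibly stable under inversion, so the induction carries both statements.
  suffices h : Q x ∧ Q x⁻¹ from h.1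
  induction x using bs_induction with
  | one =>
    have : Q 1 := fun j => ⟨j, fun k hk => ⟨k, hk, by simp⟩⟩
    exact ⟨this, by rwa [inv_one]⟩
  | a =>
    refine ⟨fun j => ⟨j, fun k hk => ⟨k, hk, by group⟩⟩, fun j => ⟨j, fun k hk => ⟨k, hk, by group⟩⟩⟩
  | t =>
    -- Conjugation by t trades a factor M for N, and t⁻¹ the reverse; one spare factor MN pays for
    -- either.
    refine ⟨fun j => ⟨j + 1, ?_⟩, fun j => ⟨j + 1, ?_⟩⟩
    · rintro _ ⟨c, rfl⟩
      refine ⟨n * (N * (M * N) ^ j * c), ⟨N * N * c, by rw [hn]; ring⟩, ?_⟩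
      rw [← bs_conj_t, show d * (M * N) ^ (j + 1) * c = m * (N * (M * N) ^ j * c) by
        rw [hm]; ring]
    · rintro _ ⟨c, rfl⟩
      refine ⟨m * (M * (M * N) ^ j * c), ⟨M * M * c, by rw [hm]; ring⟩, ?_⟩
      rw [← bs_conj_t_inv, show d * (M * N) ^ (j + 1) * c = n * (M * (M * N) ^ j * c) by
        rw [hn]; ring, inv_inv]
  | mul x y hx hy => exact ⟨mul _ _ hx.1 hy.1, by rw [mul_inv_rev]; exact mul _ _ hy.2 hx.2⟩
  | inv x hx => exact ⟨hx.2, by rw [inv_inv]; exact hx.1⟩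

theorem addRight_one_zpow_apply {R : Type*} [Ring R] (k : ℤ) (x : R) :
    ((Equiv.addRight (1 : R)) ^ k : Equiv.Perm R) x = x + k := by
  induction k generalizing x with
  | zero => simp
  | succ i ih =>
    rw [zpow_add_one, Equiv.Perm.mul_apply, ih, Equiv.coe_addRight]
    push_cast
    abel
  | pred i ih =>
    rw [zpow_sub_one, Equiv.Perm.mul_apply, ih, Equiv.Perm.inv_def, Equiv.addRight_symm,
      Equiv.coe_addRight]
    push_cast
    abel

/-- The action of `BS(m, n)` on `ℚ` by affine maps: `a` acts by `x ↦ x + 1` and `t` by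
`x ↦ (n / m) * x`. -/
def bsAffine {m n : ℤ} (hm : m ≠ 0) (hn : n ≠ 0) : BS m n →* Equiv.Perm ℚ :=
  bsLift (Equiv.addRight 1)
    (Equiv.mulLeft₀ ((n : ℚ) / m) (div_ne_zero (Int.cast_ne_zero.2 hn) (Int.cast_ne_zero.2 hm))) (by
      have : (m : ℚ) ≠ 0 := Int.cast_ne_zero.2 hm
      rw [mul_inv_eq_iff_eq_mul]
      ext x
      simp only [Equiv.Perm.mul_apply, addRight_one_zpow_apply, Equiv.mulLeft₀_apply]
      field_simp)

theorem bsAffine_genA_zpow {m n : ℤ} (hm : m ≠ 0) (hn : n ≠ 0) (k : ℤ) (x : ℚ) :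
    bsAffine hm hn (bsGenA m n ^ k) x = x + k := by
  rw [map_zpow, bsAffine, bsLift_genA, addRight_one_zpow_apply]

theorem bsAffine_genT {m n : ℤ} (hm : m ≠ 0) (hn : n ≠ 0) (x : ℚ) :
    bsAffine hm hn (bsGenT m n) x = (n : ℚ) / m * x := by
  rw [bsAffine, bsLift_genT]
  simp

theorem exists_bsAffine_eq {m n : ℤ} (hm : m ≠ 0) (hn : n ≠ 0) (γ : BS m n) :
    ∃ τ : ℤ, ∃ c : ℚ, ∀ x, bsAffine hm hn γ x = ((n : ℚ) / m) ^ τ * x + c := by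
  have h0 : (n : ℚ) / m ≠ 0 := div_ne_zero (Int.cast_ne_zero.2 hn) (Int.cast_ne_zero.2 hm)
  induction γ using bs_induction with
  | one => exact ⟨0, 0, fun x => by simp⟩
  | a => exact ⟨0, 1, fun x => by simpa using bsAffine_genA_zpow hm hn 1 x⟩
  | t => exact ⟨1, 0, fun x => by rw [bsAffine_genT]; simp⟩
  | mul γ δ hγ hδ =>
    obtain ⟨τ, c, h⟩ := hγ
    obtain ⟨τ', c', h'⟩ := hδ
    refine ⟨τ + τ', ((n : ℚ) / m) ^ τ * c' + c, fun x => ?_⟩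
    rw [map_mul, Equiv.Perm.mul_apply, h', h, zpow_add₀ h0]
    ring
  | inv γ hγ =>
    obtain ⟨τ, c, h⟩ := hγ
    refine ⟨-τ, -(((n : ℚ) / m) ^ (-τ) * c), fun x => ?_⟩
    rw [map_inv, Equiv.Perm.inv_eq_iff_eq, h, zpow_neg]
    have := zpow_ne_zero τ h0
    field_simp
    ring

/-- The modular homomorphism of `BS(m, n)` takes values in the powers of `n / m`. -/
theorem bs_exists_modulus {m n : ℤ} (hm : m ≠ 0) (hn : n ≠ 0) (γ : BS m n) :
    ∃ τ : ℤ, ∀ k l : ℤ, γ * bsGenA m n ^ k * γ⁻¹ = bsGenA m n ^ l →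
      (l : ℚ) = ((n : ℚ) / m) ^ τ * k := by
  obtain ⟨τ, c, h⟩ := exists_bsAffine_eq hm hn γ
  refine ⟨τ, fun k l e => ?_⟩
  -- At 0, γ a ^ k = a ^ l γ reads (n / m) ^ τ * k + c = c + l.
  have := congrArg (fun δ => bsAffine hm hn δ 0) (mul_inv_eq_iff_eq_mul.1 e)
  simp only [map_mul, Equiv.Perm.mul_apply, bsAffine_genA_zpow, h] at this
  linarith

theorem bsAffine_genT_pow {m n : ℤ} (hm : m ≠ 0) (hn : n ≠ 0) (j : ℕ) (x : ℚ) :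
    bsAffine hm hn (bsGenT m n ^ j) x = ((n : ℚ) / m) ^ j * x := by
  induction j generalizing x with
  | zero => simp
  | succ j ih =>
    rw [pow_succ, map_mul, Equiv.Perm.mul_apply, ih, bsAffine_genT, pow_succ]
    ring

/-- A power of `a` which lies in all conjugates of `⟨a⟩` is trivial. -/
theorem bs_core_trivial {m n : ℤ} (hm : m ≠ 0) (hmn : |m| < n) {k : ℤ}
    (h : ∀ γ : BS m n, γ⁻¹ * bsGenA m n ^ k * γ ∈ bsA m n) : k = 0 := by
  have hn0 : (0 : ℚ) < n := by exact_mod_cast (abs_nonneg m).trans_lt hmn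
  have hn : n ≠ 0 := by exact_mod_cast hn0.ne'
  have hm' : (m : ℚ) ≠ 0 := Int.cast_ne_zero.2 hm
  have hlt : |(m : ℚ) / n| < 1 := by
    rw [abs_div, abs_of_pos hn0, div_lt_one hn0]
    exact_mod_cast hmn
  -- Conjugating by t ^ (-j) multiplies the exponent by (m / n) ^ j; for this j the integer obtained
  -- has absolute value below 1.
  obtain ⟨j, hj⟩ := exists_pow_lt_of_lt_one (show (0 : ℚ) < 1 / (|(k : ℚ)| + 1) by positivity) hlt
  obtain ⟨l, hl⟩ := mem_bsA.1 (h (bsGenT m n ^ j))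
  have e : bsGenT m n ^ j * bsGenA m n ^ l = bsGenA m n ^ k * bsGenT m n ^ j := by
    rw [hl]
    group
  have e' := congrArg (fun δ => bsAffine hm hn δ 0) e
  simp only [map_mul, Equiv.Perm.mul_apply, bsAffine_genA_zpow, bsAffine_genT_pow, mul_zero,
    zero_add] at e'
  have hlk : (l : ℚ) = ((m : ℚ) / n) ^ j * k := by
    rw [← e', ← mul_assoc, ← mul_pow, div_mul_div_cancel₀ hn0.ne', div_self hm', one_pow, one_mul]
  have hl1 : |(l : ℚ)| < 1 := by
    rw [hlk, abs_mul, abs_pow]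
    have : |(m : ℚ) / n| ^ j * (|(k : ℚ)| + 1) < 1 := by
      rwa [lt_div_iff₀ (by positivity)] at hj
    nlinarith [pow_nonneg (abs_nonneg ((m : ℚ) / n)) j]
  have hl0 : l = 0 := Int.abs_lt_one_iff.1 (by exact_mod_cast hl1)
  rw [hl0] at e'
  simpa using e'.symm

/-! ### Powers of a and the base stabilizer in G(m, n) -/

/-- The image of the generator `a` in `G(m, n)`. -/
def completionA (m n : ℤ) : bsCompletion m n := completionMap (bsA m n) (bsGenA m n)

/-- The image of the generator `t` in `G(m, n)`. -/
def completionT (m n : ℤ) : bsCompletion m n := completionMap (bsA m n) (bsGenT m n)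

theorem completionMap_genA_zpow {m n : ℤ} (k : ℤ) :
    completionMap (bsA m n) (bsGenA m n ^ k) = completionA m n ^ k := map_zpow _ _ _

theorem completion_relation (m n : ℤ) :
    completionT m n * completionA m n ^ m * (completionT m n)⁻¹ = completionA m n ^ n := by
  rw [← completionMap_genA_zpow, ← completionMap_genA_zpow, ← bs_relation, map_mul, map_mul,
    map_inv]
  rfl

/-- Sufficiently divisible powers of `a` are close to the identity. -/
theorem completionA_zpow_mem_of_mem_nhds {m n d M N : ℤ} (hm : m = d * M) (hn : n = d * N)
    {U : Set (bsCompletion m n)} (hU : U ∈ 𝓝 1) :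
    ∃ i : ℕ, ∀ k : ℤ, d * (M * N) ^ i ∣ k → completionA m n ^ k ∈ U := by
  have fix : ∀ x : BS m n ⧸ bsA m n, ∃ i : ℕ, ∀ k : ℤ, d * (M * N) ^ i ∣ k →
      bsGenA m n ^ k • x = x := by
    intro x
    induction x using QuotientGroup.induction_on with
    | H x =>
      obtain ⟨i, hi⟩ := bs_commensurates hm hn x⁻¹ 0
      refine ⟨i, fun k hk => ?_⟩
      obtain ⟨l, -, hl⟩ := hi k hk
      rw [smul_coe_eq_iff, ← inv_inv x, inv_inv x⁻¹, hl]
      exact mem_bsA.2 ⟨l, rfl⟩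
  choose r hr using fix
  obtain ⟨S, hS⟩ := completion_exists_finset_of_mem_nhds hU
  refine ⟨S.sup r, fun k hk => hS _ fun x hx => ?_⟩
  rw [← completionMap_genA_zpow, completionMap_apply]
  exact hr x k ((mul_dvd_mul_left d (pow_dvd_pow _ (Finset.le_sup hx))).trans hk)

theorem exists_ne_zero_completionA_zpow_mem {m n : ℤ} (hm : m ≠ 0) (hn : n ≠ 0)
    {U : Set (bsCompletion m n)} (hU : U ∈ 𝓝 1) : ∃ k : ℤ, k ≠ 0 ∧ completionA m n ^ k ∈ U := by
  obtain ⟨i, hi⟩ := completionA_zpow_mem_of_mem_nhds (one_mul m).symm (one_mul n).symm hU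
  exact ⟨_, by positivity, hi _ dvd_rfl⟩

theorem completionA_zpow_eq_one {m n : ℤ} (hm : m ≠ 0) (hmn : |m| < n) {k : ℤ}
    (h : completionA m n ^ k = 1) : k = 0 := by
  refine bs_core_trivial hm hmn fun γ => (smul_coe_eq_iff (Λ := bsA m n) _ γ).1 ?_
  rw [← completionMap_apply, completionMap_genA_zpow, h]
  rfl

theorem completionA_zpow_injective {m n : ℤ} (hm : m ≠ 0) (hmn : |m| < n) {k l : ℤ}
    (h : completionA m n ^ k = completionA m n ^ l) : k = l := by
  refine sub_eq_zero.1 (completionA_zpow_eq_one hm hmn ?_)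
  rw [zpow_sub, h, mul_inv_cancel]

/-- An equation between continuous expressions in `g` is a closed condition, so it passes from the
powers of a to the whole base stabilizer. -/
theorem commute_completionA {m n : ℤ} {g : bsCompletion m n} (hg : g ∈ baseStabilizer (bsA m n)) :
    Commute g (completionA m n) := by
  have hC : IsClosed {g : bsCompletion m n | g * completionA m n = completionA m n * g} :=
    isClosed_eq (by fun_prop) (by fun_prop)
  refine baseStabilizer_subset_of_isClosed hC (fun γ hγ => ?_) hg
  obtain ⟨k, rfl⟩ := mem_bsA.1 hγ
  rw [completionMap_genA_zpow]
  exact ((Commute.refl (completionA m n)).zpow_left k).eq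

/-- An abstract isomorphism need not match powers of a, so the relation is needed for every element
of the base stabilizer. It follows by closedness. -/
theorem completion_relation_baseStabilizer {m n : ℤ} {g : bsCompletion m n}
    (hg : g ∈ baseStabilizer (bsA m n)) :
    completionT m n * g ^ m * (completionT m n)⁻¹ = g ^ n := by
  have hC : IsClosed {g : bsCompletion m n |
      completionT m n * g ^ m * (completionT m n)⁻¹ = g ^ n} :=
    isClosed_eq (by fun_prop) (by fun_prop)
  refine baseStabilizer_subset_of_isClosed hC (fun γ hγ => ?_) hg
  obtain ⟨k, rfl⟩ := mem_bsA.1 hγ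
  rw [completionMap_genA_zpow, Set.mem_ofPred_eq, zpow_comm _ k n, ← completion_relation, conj_zpow,
    zpow_comm]

theorem exists_unit_of_abs_eq {m n : ℤ} (hmn : |m| = n) : ∃ ε : ℤ, ε * ε = 1 ∧ m = n * ε := by
  subst hmn
  rcases abs_choice m with h | h
  · exact ⟨1, by norm_num, by rw [h, mul_one]⟩
  · exact ⟨-1, by norm_num, by rw [h, neg_mul_neg, mul_one]⟩

theorem dvd_of_unit_pow {n ε : ℤ} (hε : ε * ε = 1) (i : ℕ) : n * (ε * 1) ^ i ∣ n :=
  ⟨ε ^ i, by rw [mul_one, mul_assoc, ← mul_pow, hε, one_pow, mul_one]⟩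

/-- With d = n, M = ±1 and N = 1, the divisibility required near 1 is always by n up to sign. Hence
a ^ n lies in every neighbourhood of 1, and the group is Hausdorff. -/
theorem completionA_zpow_eq_one_of_abs_eq {m n : ℤ} (hmn : |m| = n) :
    completionA m n ^ n = 1 := by
  obtain ⟨ε, hε, h⟩ := exists_unit_of_abs_eq hmn
  by_contra hne
  obtain ⟨i, hi⟩ := completionA_zpow_mem_of_mem_nhds h (mul_one n).symm
    (isOpen_compl_singleton.mem_nhds (Ne.symm hne : (1 : bsCompletion m n) ∈ {_}ᶜ))
  exact hi n (dvd_of_unit_pow hε i) rfl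

/-- In the unimodular case the base stabilizer has exponent dividing `n`. -/
theorem zpow_eq_one_of_abs_eq {m n : ℤ} (hmn : |m| = n) {g : bsCompletion m n}
    (hg : g ∈ baseStabilizer (bsA m n)) : g ^ n = 1 := by
  have hC : IsClosed {g : bsCompletion m n | g ^ n = 1} := isClosed_eq (by fun_prop) (by fun_prop)
  refine baseStabilizer_subset_of_isClosed hC (fun γ hγ => ?_) hg
  obtain ⟨k, rfl⟩ := mem_bsA.1 hγ
  rw [completionMap_genA_zpow, Set.mem_ofPred_eq, zpow_comm, completionA_zpow_eq_one_of_abs_eq hmn,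
    one_zpow]

/-- Elements of `G(m, n)` conjugate powers of `a` with ratio a power of `n / m`. -/
theorem completion_exists_modulus {m n : ℤ} (hm : m ≠ 0) (hmn : |m| < n) (g : bsCompletion m n) :
    ∃ τ : ℤ, ∀ k l : ℤ, g * completionA m n ^ k * g⁻¹ = completionA m n ^ l →
      (l : ℚ) = ((n : ℚ) / m) ^ τ * k := by
  have hn : n ≠ 0 := ((abs_nonneg m).trans_lt hmn).ne'
  -- Since `c` commutes with a, `g` and `γ` conjugate powers of a identically.
  obtain ⟨γ, c, hc, rfl⟩ := completion_eq_mul g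
  obtain ⟨τ, hτ⟩ := bs_exists_modulus hm hn γ
  -- Raising exponents to a multiple of `e` yields an identity already valid in BS(m, n), where the
  -- modulus is known; `e` is cancelled at the end.
  obtain ⟨i, hi⟩ := bs_commensurates (one_mul m).symm (one_mul n).symm γ 0
  set e : ℤ := 1 * (m * n) ^ i
  have he : (e : ℚ) ≠ 0 := Int.cast_ne_zero.2 (by positivity)
  refine ⟨τ, fun k l h => ?_⟩
  obtain ⟨l', -, hl'⟩ := hi (k * e) (dvd_mul_left _ _)
  have hck : c * completionA m n ^ k * c⁻¹ = completionA m n ^ k := by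
    rw [((commute_completionA hc).zpow_right k).eq, mul_inv_cancel_right]
  have h1 : completionMap (bsA m n) γ * completionA m n ^ k * (completionMap (bsA m n) γ)⁻¹ =
      completionA m n ^ l := by
    rw [← h, mul_inv_rev]
    nth_rewrite 1 [← hck]
    group
  have h2 : l * e = l' := by
    refine completionA_zpow_injective hm hmn ?_
    rw [← completionMap_genA_zpow l', ← hl', zpow_mul, ← h1, conj_zpow, ← zpow_mul, map_mul,
      map_mul, map_inv, completionMap_genA_zpow]
  have h3 := hτ _ _ hl'
  rw [← h2] at h3
  push_cast at h3
  rw [← mul_assoc] at h3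
  exact mul_right_cancel₀ he h3

/-! ### Invariance of the ratio -/

theorem exists_mem_nhds_one_forall_exists_map_eq {G H : Type*} [Group G] [Group H]
    [TopologicalSpace G] [TopologicalSpace H] (φ : G ≃ₜ* H) {K : Subgroup G}
    (hK : IsOpen (K : Set G)) : ∃ U ∈ 𝓝 (1 : H), ∀ y ∈ U, ∃ x ∈ K, φ x = y := by
  refine ⟨_, (hK.preimage φ.symm.continuous_toFun).mem_nhds ?_,
    fun y hy => ⟨φ.symm y, hy, φ.apply_symm_apply y⟩⟩
  rw [Set.mem_preimage]
  change φ.symm 1 ∈ K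
  rw [map_one]
  exact one_mem _

/-- The image of the base stabilizer is an open neighbourhood of 1, and nonzero powers of a
accumulate at 1. -/
theorem exists_mem_baseStabilizer_map_eq {m n p q : ℤ} (hp : p ≠ 0) (hq : q ≠ 0)
    (φ : bsCompletion m n ≃ₜ* bsCompletion p q) :
    ∃ k : ℤ, k ≠ 0 ∧ ∃ x ∈ baseStabilizer (bsA m n), φ x = completionA p q ^ k := by
  obtain ⟨U, hU, h⟩ :=
    exists_mem_nhds_one_forall_exists_map_eq φ (isOpen_baseStabilizer (bsA m n))
  obtain ⟨k, hk, hmem⟩ := exists_ne_zero_completionA_zpow_mem hp hq hU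
  exact ⟨k, hk, h _ hmem⟩

theorem map_conj_zpow_eq {G H : Type*} [Group G] [Group H] (φ : G →* H) {s x : G} {m n : ℤ}
    (h : s * x ^ m * s⁻¹ = x ^ n) : φ s * φ x ^ m * (φ s)⁻¹ = φ x ^ n := by
  rw [← map_zpow, ← map_zpow, ← h, map_mul, map_mul, map_inv]

theorem map_zpow_eq_one {G H : Type*} [Group G] [Group H] (φ : G →* H) {x : G} {n : ℤ}
    (h : x ^ n = 1) : φ x ^ n = 1 := by
  rw [← map_zpow, h, map_one]

/-- If `G(m, n)` and `G(p, q)` are isomorphic and `|p| < q`, then `|m| ≠ n` and `n / m` is a power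
of `q / p`. -/
theorem ratio_eq_zpow_of_equiv {m n p q : ℤ} (hn : n ≠ 0) (hp : p ≠ 0) (hpq : |p| < q)
    (φ : bsCompletion m n ≃ₜ* bsCompletion p q) :
    |m| ≠ n ∧ ∃ τ : ℤ, (n : ℚ) = ((q : ℚ) / p) ^ τ * m := by
  have hq : q ≠ 0 := ((abs_nonneg p).trans_lt hpq).ne'
  obtain ⟨k, hk, x, hx, hφ⟩ := exists_mem_baseStabilizer_map_eq hp hq φ
  let f : bsCompletion m n →* bsCompletion p q := φ.toMulEquiv.toMonoidHom
  have hf : f x = completionA p q ^ k := hφ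
  refine ⟨fun h => ?_, ?_⟩
  · have h1 := map_zpow_eq_one f (zpow_eq_one_of_abs_eq h hx)
    rw [hf, ← zpow_mul] at h1
    exact mul_ne_zero hk hn (completionA_zpow_eq_one hp hpq h1)
  · have h1 := map_conj_zpow_eq f (completion_relation_baseStabilizer hx)
    rw [hf, ← zpow_mul, ← zpow_mul] at h1
    obtain ⟨τ, hτ⟩ := completion_exists_modulus hp hpq (f (completionT m n))
    refine ⟨τ, mul_left_cancel₀ (Int.cast_ne_zero.2 hk : (k : ℚ) ≠ 0) ?_⟩
    have := hτ _ _ h1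
    push_cast at this
    rw [this]
    ring

theorem div_eq_div_of_equiv {m n p q : ℤ} (hm : m ≠ 0) (hmn : |m| < n) (hp : p ≠ 0) (hpq : |p| < q)
    (φ : bsCompletion m n ≃ₜ* bsCompletion p q) : (n : ℚ) / m = (q : ℚ) / p := by
  have hn : n ≠ 0 := ((abs_nonneg m).trans_lt hmn).ne'
  have hq : q ≠ 0 := ((abs_nonneg p).trans_lt hpq).ne'
  have hm' : (m : ℚ) ≠ 0 := Int.cast_ne_zero.2 hm
  have hp' : (p : ℚ) ≠ 0 := Int.cast_ne_zero.2 hp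
  obtain ⟨-, τ, hτ⟩ := ratio_eq_zpow_of_equiv hn hp hpq φ
  obtain ⟨-, σ, hσ⟩ := ratio_eq_zpow_of_equiv hq hm hmn φ.symm
  rw [← div_eq_iff hm'] at hτ
  rw [← div_eq_iff hp'] at hσ
  have one_lt : ∀ {x y : ℤ}, x ≠ 0 → |x| < y → 1 < |(y : ℚ) / x| := by
    intro x y hx hxy
    have hx' : (0 : ℚ) < |(x : ℚ)| := abs_pos.2 (Int.cast_ne_zero.2 hx)
    rw [abs_div, one_lt_div hx']
    exact lt_of_lt_of_le (by exact_mod_cast hxy) (le_abs_self _)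
  have hr := one_lt hm hmn
  have hs := one_lt hp hpq
  -- Both ratios exceed 1 in absolute value and each is a power of the other, so the exponents are
  -- positive with product 1.
  have hτ0 : 0 < τ := by
    by_contra! h
    rw [hτ, abs_zpow] at hr
    exact absurd (zpow_le_one_of_nonpos₀ hs.le h) (not_le.2 hr)
  have hσ0 : 0 < σ := by
    by_contra! h
    rw [hσ, abs_zpow] at hs
    exact absurd (zpow_le_one_of_nonpos₀ hr.le h) (not_le.2 hs)
  have h1 : |(n : ℚ) / m| ^ (σ * τ) = |(n : ℚ) / m| ^ (1 : ℤ) := by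
    rw [zpow_mul, ← abs_zpow, ← hσ, ← abs_zpow, ← hτ, zpow_one]
  have h2 : σ * τ = 1 := zpow_right_injective₀ (zero_lt_one.trans hr) hr.ne' h1
  have : τ = 1 := by nlinarith
  rw [hτ, this, zpow_one]

/-! ### Invariance of the gcd -/

/-- The permutation `Sum.inl x ↦ Sum.inl (x + 1)` of two copies of a ring. -/
def shiftLeft (R : Type*) [Ring R] : Equiv.Perm (R ⊕ R) :=
  Equiv.Perm.sumCongrHom R R (Equiv.addRight 1, 1)

theorem shiftLeft_zpow_inl {R : Type*} [Ring R] (k : ℤ) (x : R) :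
    (shiftLeft R ^ k) (Sum.inl x) = Sum.inl (x + k) := by
  rw [shiftLeft, ← map_zpow, ← addRight_one_zpow_apply]
  rfl

theorem shiftLeft_zpow_inr {R : Type*} [Ring R] (k : ℤ) (x : R) :
    (shiftLeft R ^ k) (Sum.inr x) = Sum.inr x := by
  rw [shiftLeft, ← map_zpow, Prod.pow_mk, one_zpow]
  rfl

theorem shiftLeft_zpow_eq_one {R : Type*} [Ring R] {k : ℤ} (hk : (k : R) = 0) :
    shiftLeft R ^ k = 1 := by
  ext x
  rcases x with x | x
  · rw [shiftLeft_zpow_inl, hk, add_zero, Equiv.Perm.one_apply]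
  · rw [shiftLeft_zpow_inr, Equiv.Perm.one_apply]

/-- Let a shift the left of two copies of ℤ/d and let t swap the copies; the relation holds because
a ^ m and a ^ n act trivially. If a ^ k t = t a ^ l, the left side sends `Sum.inr 0` to `Sum.inl k`
and the right side sends it to `Sum.inl 0`. -/
theorem bs_dvd_of_conj_mem {m n : ℤ} {d : ℕ} (hm : (d : ℤ) ∣ m) (hn : (d : ℤ) ∣ n) {k : ℤ}
    (h : (bsGenT m n)⁻¹ * bsGenA m n ^ k * bsGenT m n ∈ bsA m n) : (d : ℤ) ∣ k := by
  obtain ⟨l, hl⟩ := mem_bsA.1 h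
  have hrel : Equiv.sumComm (ZMod d) (ZMod d) * shiftLeft (ZMod d) ^ m *
      (Equiv.sumComm (ZMod d) (ZMod d) : Equiv.Perm (ZMod d ⊕ ZMod d))⁻¹ =
        shiftLeft (ZMod d) ^ n := by
    rw [shiftLeft_zpow_eq_one ((ZMod.intCast_zmod_eq_zero_iff_dvd m d).2 hm),
      shiftLeft_zpow_eq_one ((ZMod.intCast_zmod_eq_zero_iff_dvd n d).2 hn), mul_one,
      mul_inv_cancel]
  rw [mul_assoc, eq_inv_mul_iff_mul_eq] at hl
  have e := congrArg (fun γ => bsLift _ _ hrel γ (Sum.inr (0 : ZMod d))) hl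
  simp only [map_mul, map_zpow, bsLift_genA, bsLift_genT, Equiv.Perm.mul_apply,
    shiftLeft_zpow_inr, Equiv.sumComm_apply, Sum.swap_inr, shiftLeft_zpow_inl, zero_add,
    Sum.inl.injEq] at e
  exact (ZMod.intCast_zmod_eq_zero_iff_dvd k d).1 e.symm

theorem ofAdd_zpow_eq_one {d : ℕ} {k : ℤ} (hk : (d : ℤ) ∣ k) (x : Multiplicative (ZMod d × ZMod d)) :
    x ^ k = 1 := by
  refine Multiplicative.toAdd.injective ?_
  rw [toAdd_zpow, toAdd_one]
  have := (ZMod.intCast_zmod_eq_zero_iff_dvd k d).2 hk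
  ext <;> simp [this]

/-- The map a ↦ (1, 0), t ↦ (0, 1) extends to the completion: an element fixing the cosets of 1 and
t is some a ^ k with d ∣ k, which it kills. -/
theorem exists_surjective_of_dvd {m n : ℤ} {d : ℕ} (hm : (d : ℤ) ∣ m) (hn : (d : ℤ) ∣ n) :
    ∃ χ : bsCompletion m n →* Multiplicative (ZMod d × ZMod d),
      IsOpen (χ.ker : Set (bsCompletion m n)) ∧ Function.Surjective χ := by
  classical
  have hrel : Multiplicative.ofAdd ((0, 1) : ZMod d × ZMod d) *
      Multiplicative.ofAdd ((1, 0) : ZMod d × ZMod d) ^ m *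
        (Multiplicative.ofAdd ((0, 1) : ZMod d × ZMod d))⁻¹ =
      Multiplicative.ofAdd ((1, 0) : ZMod d × ZMod d) ^ n := by
    rw [ofAdd_zpow_eq_one hm, ofAdd_zpow_eq_one hn, mul_one, mul_inv_cancel]
  obtain ⟨χ, hχ, hf⟩ := exists_extension (Λ := bsA m n) (bsLift _ _ hrel)
    {((1 : BS m n) : BS m n ⧸ bsA m n), (bsGenT m n : BS m n ⧸ bsA m n)} (by
      intro γ hγ
      have h1 := (smul_coe_eq_iff γ 1).1 (hγ _ (by simp))
      rw [inv_one, one_mul, mul_one] at h1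
      obtain ⟨k, rfl⟩ := mem_bsA.1 h1
      have h2 := (smul_coe_eq_iff _ _).1 (hγ (bsGenT m n : BS m n ⧸ bsA m n) (by simp))
      rw [map_zpow, bsLift_genA, ofAdd_zpow_eq_one (bs_dvd_of_conj_mem hm hn h2)])
  refine ⟨χ, hχ, fun z => ?_⟩
  obtain ⟨i, hi⟩ := ZMod.intCast_surjective (Multiplicative.toAdd z).1
  obtain ⟨j, hj⟩ := ZMod.intCast_surjective (Multiplicative.toAdd z).2
  refine ⟨completionMap _ (bsGenA m n ^ i * bsGenT m n ^ j), ?_⟩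
  rw [hf, map_mul, map_zpow, map_zpow, bsLift_genA, bsLift_genT]
  refine Multiplicative.toAdd.injective ?_
  ext <;> simp [hi, hj]

/-- Multiplication by d removes the x-terms: d = dβv₁, 0 = dβv₂ and d = dδv₂, so d = (dβv₁)(δv₂) =
0. Thus if x and v generate (ℤ/k)² and dx = 0, then k divides d. -/
theorem eq_zero_of_combinations {R : Type*} [CommRing R] {d α β γ δ x₁ x₂ v₁ v₂ : R}
    (h₁ : d * x₁ = 0) (h₂ : d * x₂ = 0) (e₁₁ : α * x₁ + β * v₁ = 1) (e₁₂ : α * x₂ + β * v₂ = 0)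
    (e₂₂ : γ * x₂ + δ * v₂ = 1) : d = 0 := by
  have a : d = d * β * v₁ := by linear_combination α * h₁ - d * e₁₁
  have b : d * β * v₂ = 0 := by linear_combination d * e₁₂ - α * h₂
  have c : d = d * δ * v₂ := by linear_combination γ * h₂ - d * e₂₂
  linear_combination c + (δ * v₂) * a + v₁ * δ * b

/-- The image u of a is killed by d(MN) ^ i, because such powers of a enter the open kernel, and by
n - m = d(N - M), because the target is abelian. As MN and N - M are coprime, du = 0. -/
theorem dvd_of_surjective {m n d M N : ℤ} (hm : m = d * M) (hn : n = d * N) (hMN : IsCoprime M N)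
    {k : ℕ} (χ : bsCompletion m n →* Multiplicative (ZMod k × ZMod k))
    (hχ : IsOpen (χ.ker : Set (bsCompletion m n))) (hs : Function.Surjective χ) :
    (k : ℤ) ∣ d := by
  set u := Multiplicative.toAdd (χ (completionA m n)) with hu
  set v := Multiplicative.toAdd (χ (completionT m n)) with hv
  obtain ⟨i, hi⟩ := completionA_zpow_mem_of_mem_nhds hm hn (hχ.mem_nhds (one_mem _))
  have h1 : (d * (M * N) ^ i) • u = 0 := by
    have : χ (completionA m n ^ (d * (M * N) ^ i)) = 1 := hi _ dvd_rfl
    rw [map_zpow] at this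
    exact congrArg Multiplicative.toAdd this
  have h2 : m • u = n • u := by
    have := map_conj_zpow_eq χ (completion_relation m n)
    rw [mul_comm, inv_mul_cancel_left] at this
    exact congrArg Multiplicative.toAdd this
  have hcop : IsCoprime ((M * N) ^ i) (N - M) := by
    refine IsCoprime.pow_left (IsCoprime.mul_left ?_ ?_)
    · simpa [sub_eq_add_neg] using hMN.add_mul_left_right (-1)
    · simpa [sub_eq_add_neg, add_comm] using hMN.symm.neg_right.add_mul_left_right 1
  obtain ⟨r, s, hrs⟩ := hcop
  have h3 : d • u = 0 := by
    have h4 : (d * (N - M)) • u = 0 := by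
      rw [mul_sub, ← hm, ← hn, sub_smul, h2, sub_self]
    calc d • u = (r * (d * (M * N) ^ i) + s * (d * (N - M))) • u := by
          congr 1
          linear_combination (-d) * hrs
      _ = 0 := by rw [add_smul, mul_smul, mul_smul s, h1, h4, smul_zero, smul_zero, add_zero]
  -- The image of BS(m, n) is dense and the kernel is open, so `χ` is already surjective on that
  -- image, which u and v generate.
  have span : ∀ z : ZMod k × ZMod k, ∃ α β : ℤ, z = α • u + β • v := by
    have hΓ : ∀ γ : BS m n, ∃ α β : ℤ,
        Multiplicative.toAdd (χ (completionMap _ γ)) = α • u + β • v := by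
      intro γ
      induction γ using bs_induction with
      | one => exact ⟨0, 0, by simp⟩
      | a => exact ⟨1, 0, by rw [one_smul, zero_smul, add_zero]; rfl⟩
      | t => exact ⟨0, 1, by rw [one_smul, zero_smul, zero_add]; rfl⟩
      | mul x y hx hy =>
        obtain ⟨α, β, h⟩ := hx
        obtain ⟨α', β', h'⟩ := hy
        refine ⟨α + α', β + β', ?_⟩
        rw [map_mul, map_mul, toAdd_mul, h, h', add_smul, add_smul]
        abel
      | inv x hx =>
        obtain ⟨α, β, h⟩ := hx
        refine ⟨-α, -β, ?_⟩
        rw [map_inv, map_inv, toAdd_inv, h, neg_smul, neg_smul]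
        abel
    intro z
    obtain ⟨g, hg⟩ := hs (Multiplicative.ofAdd z)
    obtain ⟨γ, hγ⟩ := completion_exists_inv_mul_mem hχ g
    obtain ⟨α, β, h⟩ := hΓ γ
    refine ⟨α, β, ?_⟩
    rw [MonoidHom.mem_ker, map_mul, map_inv, inv_mul_eq_one, hg] at hγ
    rw [← h, ← hγ, toAdd_ofAdd]
  obtain ⟨α, β, h⟩ := span (1, 0)
  obtain ⟨γ, δ, h'⟩ := span (0, 1)
  rw [← ZMod.intCast_zmod_eq_zero_iff_dvd]
  have c1 := congrArg Prod.fst h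
  have c2 := congrArg Prod.snd h
  have c3 := congrArg Prod.snd h'
  have c4 := congrArg Prod.fst h3
  have c5 := congrArg Prod.snd h3
  simp only [Prod.fst_add, Prod.snd_add, zsmul_eq_mul, Prod.fst_zero,
    Prod.snd_zero] at c1 c2 c3 c4 c5
  exact eq_zero_of_combinations c4 c5 c1.symm c2.symm c3.symm

theorem exists_transport_surjective {G G' H : Type*} [Group G] [Group G'] [Group H]
    [TopologicalSpace G] [TopologicalSpace G'] (φ : G ≃ₜ* G') {χ : G →* H}
    (hχ : IsOpen (χ.ker : Set G)) (hs : Function.Surjective χ) :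
    ∃ χ' : G' →* H, IsOpen (χ'.ker : Set G') ∧ Function.Surjective χ' :=
  ⟨χ.comp φ.symm.toMulEquiv.toMonoidHom, hχ.preimage φ.symm.continuous_toFun,
    hs.comp φ.symm.surjective⟩

/-- The greatest common divisor of `m` and `n` is an invariant of `G(m, n)`. -/
theorem gcd_dvd_gcd_of_equiv {m n p q : ℤ} (hp : p ≠ 0)
    (φ : bsCompletion m n ≃ₜ* bsCompletion p q) : Int.gcd m n ∣ Int.gcd p q := by
  obtain ⟨χ, hχ, hs⟩ := exists_surjective_of_dvd (Int.gcd_dvd_left m n) (Int.gcd_dvd_right m n)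
  obtain ⟨χ', hχ', hs'⟩ := exists_transport_surjective φ hχ hs
  obtain ⟨M, N, hMN, hM, hN⟩ := Int.exists_gcd_one (Int.gcd_pos_of_ne_zero_left q hp)
  rw [mul_comm] at hM hN
  exact Int.natCast_dvd_natCast.1
    (dvd_of_surjective hM hN (Int.isCoprime_iff_gcd_eq_one.2 hMN) χ' hχ' hs')

/-! ### The case |m| = n -/

theorem permCongr_continuous {X Y : Type*} (e : X ≃ Y) :
    Continuous (e.permCongr : Equiv.Perm X → Equiv.Perm Y) := by
  refine permContinuous_of_isOpen fun x y => ?_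
  convert permIsOpen_apply_eq (e.symm x) (e.symm y) using 1
  ext σ
  simp [Equiv.permCongr_apply, Equiv.eq_symm_apply]

theorem permCongr_mem_topologicalClosure {X Y : Type*} (e : X ≃ Y) {P : Subgroup (Equiv.Perm X)}
    {R : Subgroup (Equiv.Perm Y)} (h : ∀ σ ∈ P, e.permCongr σ ∈ R) {σ : Equiv.Perm X}
    (hσ : σ ∈ P.topologicalClosure) : e.permCongr σ ∈ R.topologicalClosure :=
  map_mem_closure (permCongr_continuous e) hσ h

/-- A bijection intertwining two groups of permutations induces an isomorphism of their
closures. -/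
theorem nonempty_topologicalClosure_equiv {X Y : Type*} (e : X ≃ Y) {P : Subgroup (Equiv.Perm X)}
    {R : Subgroup (Equiv.Perm Y)} (h : ∀ σ ∈ P, e.permCongr σ ∈ R)
    (h' : ∀ σ ∈ R, e.symm.permCongr σ ∈ P) :
    Nonempty (P.topologicalClosure ≃ₜ* R.topologicalClosure) :=
  ⟨{ toFun := fun σ => ⟨e.permCongr σ.1, permCongr_mem_topologicalClosure e h σ.2⟩
     invFun := fun σ => ⟨e.symm.permCongr σ.1, permCongr_mem_topologicalClosure e.symm h' σ.2⟩
     left_inv := fun σ => Subtype.ext (by ext x; simp [Equiv.permCongr_apply])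
     right_inv := fun σ => Subtype.ext (by ext x; simp [Equiv.permCongr_apply])
     map_mul' := fun σ τ => Subtype.ext (by ext x; simp [Equiv.permCongr_apply])
     continuous_toFun :=
      ((permCongr_continuous e).comp continuous_subtype_val).subtype_mk _
     continuous_invFun :=
      ((permCongr_continuous e.symm).comp continuous_subtype_val).subtype_mk _ }⟩

/-- The relative profinite completion does not change on passing to a quotient by a normal subgroup
contained in `Λ`. -/
theorem nonempty_completion_equiv_map {Γ Q : Type*} [Group Γ] [Group Q] {Λ : Subgroup Γ}
    (f : Γ →* Q) (hf : Function.Surjective f) (hker : f.ker ≤ Λ) :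
    Nonempty (relativeProfiniteCompletion Λ ≃ₜ* relativeProfiniteCompletion (Λ.map f)) := by
  have hmem : ∀ x : Γ, f x ∈ Λ.map f ↔ x ∈ Λ := fun x => by
    rw [← Subgroup.mem_comap, Subgroup.comap_map_eq, sup_eq_left.2 hker]
  let F : Γ ⧸ Λ → Q ⧸ Λ.map f := Quotient.map' f fun x y h => by
    rw [QuotientGroup.leftRel_apply] at h ⊢
    rwa [← map_inv, ← map_mul, hmem]
  have hF : Function.Bijective F := by
    constructor
    · intro x y
      induction x using QuotientGroup.induction_on with
      | H x =>
      induction y using QuotientGroup.induction_on with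
      | H y =>
      intro h
      have h1 : ((f x : Q) : Q ⧸ Λ.map f) = (f y : Q) := h
      rw [QuotientGroup.eq, ← map_inv, ← map_mul, hmem] at h1
      exact QuotientGroup.eq.2 h1
    · intro y
      induction y using QuotientGroup.induction_on with
      | H y =>
      obtain ⟨x, rfl⟩ := hf y
      exact ⟨(x : Γ ⧸ Λ), rfl⟩
  let e := Equiv.ofBijective F hF
  have he : ∀ (γ : Γ) (x : Γ ⧸ Λ), e (γ • x) = f γ • e x := by
    intro γ x
    induction x using QuotientGroup.induction_on with
    | H x => exact congrArg (fun z : Q => (z : Q ⧸ Λ.map f)) (map_mul f γ x)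
  refine nonempty_topologicalClosure_equiv e ?_ ?_
  · rintro _ ⟨γ, rfl⟩
    refine ⟨f γ, ?_⟩
    ext y
    rw [Equiv.permCongr_apply, MulAction.toPermHom_apply, MulAction.toPerm_apply,
      MulAction.toPermHom_apply, MulAction.toPerm_apply, he, Equiv.apply_symm_apply]
  · rintro _ ⟨z, rfl⟩
    obtain ⟨γ, rfl⟩ := hf z
    refine ⟨γ, ?_⟩
    ext x
    rw [Equiv.permCongr_apply, MulAction.toPermHom_apply, MulAction.toPerm_apply,
      MulAction.toPermHom_apply, MulAction.toPerm_apply, Equiv.symm_symm, ← he,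
      Equiv.symm_apply_apply]

/-- The group `⟨a, t | a ^ n⟩`. -/
abbrev CyclicFreeProduct (n : ℤ) : Type :=
  PresentedGroup ({FreeGroup.of BSLetter.a ^ n} : Set (FreeGroup BSLetter))

theorem cyclicFreeProduct_zpow_eq_one (n : ℤ) :
    (PresentedGroup.of BSLetter.a : CyclicFreeProduct n) ^ n = 1 :=
  PresentedGroup.one_of_mem (Set.mem_singleton _)

theorem bsA_zpow_normal {m n : ℤ} (hmn : |m| = n) :
    (Subgroup.zpowers (bsGenA m n ^ n)).Normal := by
  obtain ⟨ε, hε, h⟩ := exists_unit_of_abs_eq hmn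
  refine ⟨fun x hx γ => ?_⟩
  obtain ⟨k, rfl⟩ := Subgroup.mem_zpowers_iff.1 hx
  -- With d = n and MN = ±1, every multiple of n is divisible enough, and its conjugate is again a
  -- multiple of n.
  obtain ⟨i, hi⟩ := bs_commensurates h (mul_one n).symm γ 0
  obtain ⟨l, ⟨c, hc⟩, hl⟩ := hi (n * k) ((dvd_of_unit_pow hε i).mul_right k)
  rw [← zpow_mul, hl, hc, pow_zero, mul_one, zpow_mul]
  exact Subgroup.zpow_mem_zpowers _ _

/-- Modulo a ^ n both sides of the defining relation become trivial, so the quotient by `⟨a ^ n⟩`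
depends only on n. -/
theorem nonempty_equiv_cyclicFreeProduct {m n : ℤ} (hmn : |m| = n) :
    Nonempty (bsCompletion m n ≃ₜ* relativeProfiniteCompletion
      (Subgroup.zpowers (PresentedGroup.of BSLetter.a : CyclicFreeProduct n))) := by
  have hrel : (PresentedGroup.of BSLetter.t : CyclicFreeProduct n) *
      PresentedGroup.of BSLetter.a ^ m * (PresentedGroup.of BSLetter.t)⁻¹ =
        PresentedGroup.of BSLetter.a ^ n := by
    obtain ⟨ε, -, h⟩ := exists_unit_of_abs_eq hmn
    rw [cyclicFreeProduct_zpow_eq_one, h, zpow_mul, cyclicFreeProduct_zpow_eq_one, one_zpow,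
      mul_one, mul_inv_cancel]
  have hN := bsA_zpow_normal hmn
  let f : BS m n →* CyclicFreeProduct n := bsLift _ _ hrel
  let π := QuotientGroup.mk' (Subgroup.zpowers (bsGenA m n ^ n))
  have hπ : π (bsGenA m n) ^ n = 1 := by
    rw [← map_zpow]
    exact (QuotientGroup.eq_one_iff _).2 (Subgroup.mem_zpowers _)
  let g : CyclicFreeProduct n →* BS m n ⧸ Subgroup.zpowers (bsGenA m n ^ n) :=
    PresentedGroup.toGroup
      (f := fun l => BSLetter.casesOn l (π (bsGenA m n)) (π (bsGenT m n))) (by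
        rintro r rfl
        rw [map_zpow, FreeGroup.lift_apply_of]
        exact hπ)
  -- Factoring `π` through `f` bounds the kernel of `f` by `⟨a ^ n⟩`, with no need to show that `g`
  -- is an isomorphism.
  have hgf : g.comp f = π := by
    refine PresentedGroup.ext fun x => ?_
    cases x
    · exact (congrArg g (bsLift_genA _ _ hrel)).trans (PresentedGroup.toGroup.of _)
    · exact (congrArg g (bsLift_genT _ _ hrel)).trans (PresentedGroup.toGroup.of _)
  have hker : f.ker ≤ bsA m n := by
    intro x hx
    have h1 : π x = 1 := by
      rw [← hgf, MonoidHom.comp_apply, MonoidHom.mem_ker.1 hx, map_one]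
    obtain ⟨k, rfl⟩ := Subgroup.mem_zpowers_iff.1 ((QuotientGroup.eq_one_iff x).1 h1)
    exact mem_bsA.2 ⟨n * k, zpow_mul _ _ _⟩
  have hsurj : Function.Surjective f := fun y => by
    refine PresentedGroup.generated_by _ f.range (fun x => ?_) y
    cases x
    · exact ⟨_, bsLift_genA _ _ hrel⟩
    · exact ⟨_, bsLift_genT _ _ hrel⟩
  have hmap : (bsA m n).map f =
      Subgroup.zpowers (PresentedGroup.of BSLetter.a : CyclicFreeProduct n) := by
    rw [bsA, MonoidHom.map_zpowers]
    exact congrArg Subgroup.zpowers (bsLift_genA _ _ hrel)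
  rw [← hmap]
  exact nonempty_completion_equiv_map f hsurj hker

/-! ### The classification -/

theorem mainTheorem3 (m n p q : ℤ) (hm : 2 ≤ |m|) (hmn : |m| ≤ n) (hp : 2 ≤ |p|) (hpq : |p| ≤ q) :
    (Nonempty (bsCompletion m n ≃ₜ* bsCompletion p q) ↔
      ((|m| = n ∧ n = |p| ∧ |p| = q) ∨ (|m| ≠ n ∧ (m, n) = (p, q)))) ∧
    (|m| ≠ n → ¬ Nonempty (bsCompletion m n ≃ₜ* bsCompletion (-m) n)) := by
  have forward : ∀ {m n p q : ℤ}, 2 ≤ |m| → |m| ≤ n → 2 ≤ |p| → |p| ≤ q →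
      Nonempty (bsCompletion m n ≃ₜ* bsCompletion p q) →
        (|m| = n ∧ n = |p| ∧ |p| = q) ∨ (|m| ≠ n ∧ (m, n) = (p, q)) := by
    rintro m n p q hm hmn hp hpq ⟨φ⟩
    have hm0 : m ≠ 0 := abs_pos.1 (by omega)
    have hp0 : p ≠ 0 := abs_pos.1 (by omega)
    have hn0 : n ≠ 0 := by omega
    have hq0 : q ≠ 0 := by omega
    have hgcd : Int.gcd m n = Int.gcd p q :=
      Nat.dvd_antisymm (gcd_dvd_gcd_of_equiv hp0 φ) (gcd_dvd_gcd_of_equiv hm0 φ.symm)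
    rcases hmn.eq_or_lt with h | h
    · have hpq' : |p| = q := by
        by_contra hne
        exact (ratio_eq_zpow_of_equiv hn0 hp0 (lt_of_le_of_ne hpq hne) φ).1 h
      have gcd_eq : ∀ {x y : ℤ}, |x| = y → (Int.gcd x y : ℤ) = y := by
        rintro x y rfl
        rw [Int.gcd, Int.natAbs_abs, Nat.gcd_self, Int.natCast_natAbs]
      refine Or.inl ⟨h, ?_, hpq'⟩
      rw [hpq', ← gcd_eq h, hgcd, gcd_eq hpq']
    · have hpq' : |p| < q := by
        refine lt_of_le_of_ne hpq fun hne => ?_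
        exact (ratio_eq_zpow_of_equiv hq0 hm0 h φ.symm).1 hne
      have hdiv := div_eq_div_of_equiv hm0 h hp0 hpq' φ
      rw [div_eq_div_iff (Int.cast_ne_zero.2 hm0) (Int.cast_ne_zero.2 hp0)] at hdiv
      have hprod : n * p = q * m := by exact_mod_cast hdiv
      have hd : (Int.gcd p q : ℤ) ≠ 0 := by
        simp [Int.gcd_eq_zero_iff, hp0]
      -- From np = qm: n gcd(p, q) = gcd(np, nq) = gcd(qm, qn) = q gcd(m, n), and the gcds are equal
      -- and nonzero.
      have hnq : n = q := by
        have h1 := Int.gcd_mul_left n p q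
        have h2 := Int.gcd_mul_left q m n
        rw [hprod, mul_comm n q, h2, hgcd] at h1
        have h3 := Nat.eq_of_mul_eq_mul_right (by exact_mod_cast Nat.pos_of_ne_zero (by exact_mod_cast hd)) h1
        omega
      refine Or.inr ⟨h.ne, Prod.ext ?_ hnq⟩
      rw [hnq] at hprod
      exact (mul_left_cancel₀ hq0 hprod).symm
  refine ⟨⟨forward hm hmn hp hpq, ?_⟩, fun hne h => ?_⟩
  · rintro (⟨h1, rfl, h3⟩ | ⟨-, h⟩)
    · subst h3
      obtain ⟨φ⟩ := nonempty_equiv_cyclicFreeProduct h1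
      obtain ⟨ψ⟩ := nonempty_equiv_cyclicFreeProduct (rfl : |p| = |p|)
      exact ⟨φ.trans ψ.symm⟩
    · obtain ⟨rfl, rfl⟩ := Prod.mk.inj h
      exact ⟨ContinuousMulEquiv.refl _⟩
  · rcases forward hm hmn (by rwa [abs_neg]) (by rwa [abs_neg]) h with h | h
    · exact hne h.1
    · have := (Prod.mk.inj h.2).1
      have hm0 : m = 0 := by omega
      rw [hm0, abs_zero] at hm
      omega
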